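/- Let $X$, $Y$ be compact metric spaces and let $\phi_t:X\to X$, $\psi_t:Y\to Y$ ($t\in\mathbb R$) be continuous flows without fixed points. A \emph{flow box} of $\phi_t$ is an open set $U\subset X$ for which there are $\varepsilon>0$ and a subset $T\subset U$, closed in $U$, such that $(x,s)\mapsto\phi_s(x)$ is a homeomorphism from $T\times(-\varepsilon,\varepsilon)$ onto $U$; such a set $T$ is called a \emph{transversal}. A finite family of transversals is \emph{complete} if every point of the space lies in the orbit of a point of one of them. A Borel measure $\mu$ on $X$ is \emph{invariant} if $\mu(\phi_t(A))=\mu(A)$ for all $t\in\mathbb R$ and all Borel sets $A\subset X$. A finite invariant measure $\mu$ induces on every transversal $T$ the finite Borel measure $$\mu_T(A)=\frac{\mu(\phi_{(-\varepsilon,\varepsilon)}(A))}{2\varepsilon},\qquad A\subset T \text{ Borel},$$ where $\phi_{(-\varepsilon,\varepsilon)}(T)$ is any flow box with transversal $T$ as above (the value does not depend on $\varepsilon$). The same notions are used for $\psi_t$. A flow is \emph{uniquely ergodic} if it has exactly one invariant Borel probability measure. Let $(T_i)_{1\le i\le n}$ and $(T_i')_{1\le i\le n}$ be complete families of transversals for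 $\phi_t$ and $\psi_t$, respectively. Let $F:\bigsqcup_{i=1}^n T_i\to\bigsqcup_{i=1}^n T_i'$ be a map of the disjoint unions which restricts, for every $i$, to a homeomorphism $F|_{T_i}$ from $T_i$ onto $T_i'$, and which preserves the holonomy: for all $x,y\in\bigsqcup_i T_i$, the points $x$ and $y$ lie in the same orbit of $\phi_t$ if and only if $F(x)$ and $F(y)$ lie in the same orbit of $\psi_t$. Then there is a bijection $\Theta$ from the set of finite Borel measures on $X$ invariant by $\phi_t$ onto the set of finite Borel measures on $Y$ invariant by $\psi_t$, induced by $F$ in the following sense: for finite invariant Borel measures $\mu$ of $\phi_t$ and $\nu$ of $\psi_t$, one has $\Theta(\mu)=\nu$ if and only if $(F|_{T_i})_*\,\mu_{T_i}=\nu_{T_i'}$ for every $i\in\{1,\dots,n\}$. In particular, $\phi_t$ is uniquely ergodic if and only if $\psi_t$ is uniquely ergodic. -/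

import Mathlib

open Set MeasureTheory

/-- The flow `φ` has no fixed points: no point is fixed by all the maps `φ t`. -/
def Flow.HasNoFixedPoints {X : Type*} [TopologicalSpace X] (φ : Flow ℝ X) : Prop :=
  ∀ x : X, ¬ ∀ t : ℝ, φ t x = x

/-- `U` is a flow box of the flow `φ`, of size `ε`, with transversal `T`: `U` is open in `X`, `T` is
a subset of `U` which is closed in `U`, `ε > 0`, and `(x, s) ↦ φ s x` is a homeomorphism from
`T × (-ε, ε)` onto `U`. -/
structure Flow.IsFlowBox {X : Type*} [TopologicalSpace X] (φ : Flow ℝ X)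
    (U T : Set X) (ε : ℝ) : Prop where
  isOpen : IsOpen U
  subset : T ⊆ U
  isClosed : IsClosed {u : U | (u : X) ∈ T}
  pos : 0 < ε
  homeo : ∃ Φ : (T × Ioo (-ε) ε) ≃ₜ U, ∀ (x : T) (s : Ioo (-ε) ε), (Φ (x, s) : X) = φ s x

/-- `T` is a transversal of `φ`: it is the transversal of some flow box. -/
def Flow.IsTransversal {X : Type*} [TopologicalSpace X] (φ : Flow ℝ X) (T : Set X) : Prop :=
  ∃ (U : Set X) (ε : ℝ), φ.IsFlowBox U T ε

/-- `T₁, …, Tₙ` is a complete set of transversals: each `T i` is a transversal, and every point of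
`X` lies in the orbit of a point of some `T i`. -/
def Flow.IsCompleteTransversals {X : Type*} [TopologicalSpace X] (φ : Flow ℝ X) {n : ℕ}
    (T : Fin n → Set X) : Prop :=
  (∀ i, φ.IsTransversal (T i)) ∧ ∀ x : X, ∃ i, ∃ y ∈ T i, x ∈ φ.orbit y

/-- The maps `F i : T i → T' i`, seen as one map on the disjoint union of the `T i`, preserve the
holonomy: two points of the disjoint union lie in the same orbit of `φ` if and only if their images
lie in the same orbit of `ψ`. -/
def PreservesHolonomy {X Y : Type*} [TopologicalSpace X] [TopologicalSpace Y]
    (φ : Flow ℝ X) (ψ : Flow ℝ Y) {n : ℕ} {T : Fin n → Set X} {T' : Fin n → Set Y}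
    (F : ∀ i, T i → T' i) : Prop :=
  ∀ (i j : Fin n) (x : T i) (y : T j),
    (y : X) ∈ φ.orbit (x : X) ↔ (F j y : Y) ∈ ψ.orbit (F i x : Y)

/-- The measure `μ` is invariant by the flow: `μ (φ t (A)) = μ A` for all times `t` and all Borel
sets `A`. -/
def Flow.IsInvariantMeasure {X : Type*} [TopologicalSpace X] [MeasurableSpace X]
    (φ : Flow ℝ X) (μ : Measure X) : Prop :=
  ∀ (t : ℝ) (A : Set X), MeasurableSet A → μ (φ t '' A) = μ A

/-- The finite measures which are invariant by the flow. -/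
def Flow.FiniteInvariantMeasure {X : Type*} [TopologicalSpace X] [MeasurableSpace X]
    (φ : Flow ℝ X) : Type _ :=
  {μ : Measure X // IsFiniteMeasure μ ∧ φ.IsInvariantMeasure μ}

/-- The flow is uniquely ergodic: it has exactly one invariant probability measure. -/
def Flow.IsUniquelyErgodic {X : Type*} [TopologicalSpace X] [MeasurableSpace X]
    (φ : Flow ℝ X) : Prop :=
  ∃! μ : Measure X, IsProbabilityMeasure μ ∧ φ.IsInvariantMeasure μ

/-- The value `μ_T(A) = μ (φ_(-ε, ε) (A)) / (2 ε)` of the measure induced by `μ` on a transversal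
`T`, for a subset `A` of `T`, where `ε` is the size of a flow box with transversal `T`. (When `μ` is
invariant, this does not depend on the flow box.) -/
noncomputable def Flow.transverseMeasure {X : Type*} [TopologicalSpace X] [MeasurableSpace X]
    (φ : Flow ℝ X) (μ : Measure X) {T : Set X} (ε : ℝ) (A : Set T) : ENNReal :=
  μ {z : X | ∃ x ∈ A, ∃ s ∈ Ioo (-ε) ε, z = φ s x} / ENNReal.ofReal (2 * ε)

/-- The maps `F i : T i → T' i` carry the measures induced by `μ` on the transversals `T i` to the
measures induced by `ν` on the transversals `T' i`: one has `μ_{T i} (F i ⁻¹ (B)) = ν_{T' i} (B)` for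
all Borel subsets `B` of `T' i`, that is, `(F i)_* μ_{T i} = ν_{T' i}`. -/
def CarriesTransverseMeasures {X Y : Type*} [TopologicalSpace X] [TopologicalSpace Y]
    [MeasurableSpace X] [MeasurableSpace Y] (φ : Flow ℝ X) (ψ : Flow ℝ Y) {n : ℕ}
    {T : Fin n → Set X} {T' : Fin n → Set Y} (F : ∀ i, T i → T' i)
    (μ : Measure X) (ν : Measure Y) : Prop :=
  ∀ (i : Fin n) (U : Set X) (ε : ℝ) (U' : Set Y) (ε' : ℝ),
    φ.IsFlowBox U (T i) ε → ψ.IsFlowBox U' (T' i) ε' →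
    ∀ B : Set (T' i), MeasurableSet B →
      φ.transverseMeasure μ ε (F i ⁻¹' B) = ψ.transverseMeasure ν ε' B

/-! A finite invariant measure of a flow is the same thing as a finite measure on a cross section
that is invariant under holonomy, and `F` respects the holonomy. The cross section `Z` is the
disjoint union of the transversals, with position map `p`; it is coloured by the index because
different transversals may meet. Sweeping `(z, s) ↦ φ s (p z)` is only locally injective, so `μ` and
`m` are compared on the Borel sets of `Z × ℝ` where it is injective (`Flow.Corresponds`).

From `μ` to `m`: pulled back to `Z × ℝ`, `μ` becomes invariant under time translations, hence a
product `m × Lebesgue` by uniqueness of Haar measure (`exists_corresponds_of_isInvariantMeasure`).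
Such an `m` is holonomy invariant (`holonomyInvariant_of_corresponds`). From `m` to `μ`: `m ×
Lebesgue` is pushed forward from a Borel set that meets every fibre of the sweeping map once.
Holonomy invariance makes the choice of this set irrelevant
(`exists_corresponds_of_holonomyInvariant`). Both directions rest on writing the orbit relation on
`Z` as countably many graphs of injective Borel maps (`exists_holonomy_maps`).

The measure `m` restricts on each transversal to the induced measure, so `F` carries `μ` to `ν`
exactly when it pushes `m` to the measure of `ν` (`carriesTransverseMeasures_iff`). Unique
ergodicity transfers after rescaling, since total mass need not be preserved. -/

/-! ### Measure theory: injective Borel maps, translation invariant measures, skew products. -/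

section MeasureLemmas

open Measure

variable {α β Z : Type*} [MeasurableSpace α] [MeasurableSpace β] [MeasurableSpace Z]

/-- A Borel map which is injective on a Borel set has a Borel left inverse there. -/
theorem exists_measurable_leftInverse_on [StandardBorelSpace α] [StandardBorelSpace β]
    [Nonempty α] {f : α → β} (hf : Measurable f) {C : Set α} (hC : MeasurableSet C)
    (hinj : InjOn f C) : ∃ R : β → α, Measurable R ∧ ∀ a ∈ C, R (f a) = a := by
  have := hC.standardBorel
  have he : MeasurableEmbedding (fun a : C => f a) :=
    (hf.comp measurable_subtype_coe).measurableEmbedding (injOn_iff_injective.1 hinj)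
  obtain ⟨R, hR, h⟩ := he.exists_measurable_extend (g := fun a : C => (a : α))
    measurable_subtype_coe (fun _ => inferInstance)
  exact ⟨R, hR, fun a ha => congrFun h ⟨a, ha⟩⟩

/-- The image measure under the inverse of a map which is injective on `C`. -/
theorem exists_measure_eq_image [StandardBorelSpace α] [StandardBorelSpace β]
    [Nonempty α] {f : α → β} (hf : Measurable f) {C : Set α} (hC : MeasurableSet C)
    (hinj : InjOn f C) (ν : Measure β) :
    ∃ μ : Measure α, μ univ ≤ ν univ ∧ ∀ A, MeasurableSet A → μ A = ν (f '' (A ∩ C)) := by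
  obtain ⟨R, hR, hRf⟩ := exists_measurable_leftInverse_on hf hC hinj
  have hfC := hC.image_of_measurable_injOn hf hinj
  refine ⟨(ν.restrict (f '' C)).map R, ?_, fun A hA => ?_⟩
  · rw [map_apply hR .univ]
    exact (restrict_apply_le _ _).trans (measure_mono (subset_univ _))
  · rw [map_apply hR hA, restrict_apply (hR hA)]
    congr 1
    ext y
    constructor
    · rintro ⟨hy, a, ha, rfl⟩
      rw [mem_preimage, hRf a ha] at hy
      exact ⟨a, ⟨hy, ha⟩, rfl⟩
    · rintro ⟨a, ⟨hA, ha⟩, rfl⟩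
      exact ⟨by rwa [mem_preimage, hRf a ha], a, ha, rfl⟩

/-- If an injective Borel map preserves the measure of the subsets of each of countably many
pieces, it preserves the measure. -/
theorem measure_image_eq_of_countable_cover [StandardBorelSpace α] [StandardBorelSpace β]
    {K : Type*} [Countable K] {f : α → β} (hf : Measurable f) {C : Set α} (hC : MeasurableSet C)
    (hinj : InjOn f C) (μ : Measure α) (ν : Measure β) (S : K → Set α)
    (hS : ∀ k, MeasurableSet (S k)) (hcov : C ⊆ ⋃ k, S k)
    (h : ∀ k A, MeasurableSet A → A ⊆ C ∩ S k → ν (f '' A) = μ A) : ν (f '' C) = μ C := by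
  rcases isEmpty_or_nonempty α with hα | hα
  · simp [Set.eq_empty_of_isEmpty C]
  obtain ⟨μ', -, hμ'⟩ := exists_measure_eq_image hf hC hinj ν
  -- Measures that agree on every `S k` agree on the union, even if the pieces overlap.
  have key : (μ.restrict C).restrict (⋃ k, S k) = μ'.restrict (⋃ k, S k) := by
    refine restrict_iUnion_congr.2 fun k => ?_
    ext A hA
    rw [restrict_apply hA, restrict_apply hA, restrict_apply (hA.inter (hS k)),
      hμ' _ (hA.inter (hS k)), h k _ ((hA.inter (hS k)).inter hC)]
    rintro a ⟨⟨-, h1⟩, h2⟩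
    exact ⟨h2, h1⟩
  have := congrArg (fun m => m C) key
  simp only [restrict_apply hC, inter_eq_left.2 hcov, inter_self, hμ' C hC] at this
  exact this.symm

/-- A measure on `Z × ℝ` which is invariant by the translations of `ℝ` is a product. -/
theorem exists_prod_volume_of_translation_invariant (N : Measure (Z × ℝ)) {η : ℝ} (hη : 0 < η)
    (hfin : N (univ ×ˢ Ico 0 η) ≠ ⊤)
    (hinv : ∀ (t : ℝ) (C : Set (Z × ℝ)), MeasurableSet C →
      N ((fun w => (w.1, t + w.2)) ⁻¹' C) = N C) :
    ∃ m : Measure Z, IsFiniteMeasure m ∧ N = m.prod volume := by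
  let m : Measure Z := (ENNReal.ofReal η)⁻¹ • (N.restrict (univ ×ˢ Ico 0 η)).map Prod.fst
  have hη0 : ENNReal.ofReal η ≠ 0 := by simpa using hη
  have hm : ∀ A, MeasurableSet A → m A = (ENNReal.ofReal η)⁻¹ * N (A ×ˢ Ico 0 η) := by
    intro A hA
    rw [Measure.smul_apply, smul_eq_mul, map_apply measurable_fst hA,
      restrict_apply (measurable_fst hA)]
    congr 2
    ext w
    simp
  have hmf : IsFiniteMeasure m := ⟨by
    rw [hm _ .univ]
    exact ENNReal.mul_lt_top (by simpa using hη) hfin.lt_top⟩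
  refine ⟨m, hmf, (Measure.prod_eq fun A I hA hI => ?_).symm⟩
  -- For fixed `A`, the measure `J ↦ N (A × J)` is translation invariant on `ℝ`, hence a multiple of
  -- Lebesgue measure; the window `[0, η)` fixes the factor as `m A`.
  let ρ : Measure ℝ := (N.restrict (A ×ˢ univ)).map Prod.snd
  have hρ : ∀ J, MeasurableSet J → ρ J = N (A ×ˢ J) := by
    intro J hJ
    rw [map_apply measurable_snd hJ, restrict_apply (measurable_snd hJ)]
    congr 1
    ext w
    simp [and_comm]
  have hpre : ∀ t J, MeasurableSet J → ρ ((fun x => t + x) ⁻¹' J) = ρ J := by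
    intro t J hJ
    rw [hρ J hJ, hρ _ (measurable_const_add t hJ), ← hinv t _ (hA.prod hJ)]
    rfl
  have hρinv : ρ.IsAddLeftInvariant := ⟨fun t => by
    ext J hJ
    rw [map_apply (measurable_const_add t) hJ, hpre t J hJ]⟩
  have hρfin : ρ (Ico 0 η) < ⊤ := by
    rw [hρ _ measurableSet_Ico]
    exact (measure_mono (prod_mono_left (subset_univ A))).trans_lt hfin.lt_top
  have hρloc : IsLocallyFiniteMeasure ρ := ⟨fun x => by
    refine ⟨Ioo (x - η / 2) (x + η / 2), Ioo_mem_nhds (by linarith) (by linarith), ?_⟩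
    rw [← hpre (x - η / 2) _ measurableSet_Ioo]
    refine (measure_mono ?_).trans_lt hρfin
    intro y hy
    simp only [mem_preimage, mem_Ioo, mem_Ico] at hy ⊢
    constructor <;> linarith⟩
  obtain ⟨κ, hκ⟩ : ∃ κ : NNReal, ρ = κ • volume := ⟨_, isAddLeftInvariant_eq_smul ρ volume⟩
  have hκ' : ∀ J, ρ J = κ * volume J := fun J => by
    rw [hκ, Measure.smul_apply, ENNReal.smul_def, smul_eq_mul]
  rw [← hρ I hI, hm A hA, ← hρ _ measurableSet_Ico, hκ', hκ', Real.volume_Ico, sub_zero,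
    mul_comm (κ : ENNReal) (ENNReal.ofReal η), ← mul_assoc,
    ENNReal.inv_mul_cancel hη0 ENNReal.ofReal_ne_top, one_mul]

/-- The effect on products with the Lebesgue measure of a map which is injective on `D` and a
translation in the fibres. -/
theorem prod_volume_skew_image [StandardBorelSpace Z] (m₁ m₂ : Measure Z) [SFinite m₁] [SFinite m₂]
    {h : Z → Z} {σ : Z → ℝ} (hh : Measurable h) (hσ : Measurable σ) {D : Set Z}
    (hD : MeasurableSet D) (hinj : InjOn h D)
    (hm : ∀ B, MeasurableSet B → B ⊆ D → m₂ (h '' B) = m₁ B) {A : Set (Z × ℝ)}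
    (hA : MeasurableSet A) (hAD : A ⊆ D ×ˢ univ) :
    (m₂.prod volume) ((fun w => (h w.1, w.2 + σ w.1)) '' A) = (m₁.prod volume) A := by
  have hmap : MeasurePreserving h (m₁.restrict D) (m₂.restrict (h '' D)) := by
    refine ⟨hh, ?_⟩
    ext B hB
    rw [map_apply hh hB, restrict_apply (hh hB), restrict_apply hB,
      ← hm _ ((hh hB).inter hD) inter_subset_right, image_preimage_inter]
  have hsk : MeasurePreserving (fun w : Z × ℝ => (h w.1, w.2 + σ w.1))
      ((m₁.restrict D).prod volume) ((m₂.restrict (h '' D)).prod volume) :=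
    hmap.skew_product (g := fun z s => s + σ z) (by fun_prop)
      (Filter.Eventually.of_forall fun z => map_add_right_eq_self volume (σ z))
  have hinj' : InjOn (fun w : Z × ℝ => (h w.1, w.2 + σ w.1)) (D ×ˢ univ) := by
    rintro ⟨z, s⟩ hz ⟨z', s'⟩ hz' he
    obtain rfl := hinj hz.1 hz'.1 (congrArg Prod.fst he)
    exact congrArg (Prod.mk z) (add_right_cancel (congrArg Prod.snd he))
  have hHA := hA.image_of_measurable_injOn hsk.measurable (hinj'.mono hAD)
  have e1 := hsk.measure_preimage hHA.nullMeasurableSet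
  have hr : ∀ (m : Measure Z) [SFinite m] (B : Set Z),
      (m.restrict B).prod (volume : Measure ℝ) = (m.prod volume).restrict (B ×ˢ univ) := by
    intro m _ B
    rw [← prod_restrict, restrict_univ]
  rw [hr, hr, restrict_apply (hsk.measurable hHA), restrict_apply hHA,
    hinj'.preimage_image_inter hAD, inter_eq_left.2] at e1
  · exact e1.symm
  · rintro _ ⟨w, hw, rfl⟩
    exact ⟨⟨w.1, (hAD hw).1, rfl⟩, trivial⟩

end MeasureLemmas

/-! ### Cross sections: invariant measures of the flow versus holonomy invariant measures. -/

section CrossSections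

theorem abs_sub_lt_of_mem_Ico {s t ε : ℝ} (hs : s ∈ Ico 0 ε) (ht : t ∈ Ico 0 ε) :
    |s - t| < ε := by
  rw [mem_Ico] at hs ht
  rw [abs_lt]
  constructor <;> linarith

variable {X Z ι : Type*} [TopologicalSpace X]

/-- The map `(z, s) ↦ φ s (p z)` sweeping out the space from a cross section with position map
`p`. -/
def Flow.sweep (φ : Flow ℝ X) (p : Z → X) (w : Z × ℝ) : X := φ w.2 (p w.1)

/-- `p : Z → X` is a Borel cross section of the flow, split into pieces by the colouring `c`: on
each piece the sweeping map is injective over times varying by less than `ε`, and every orbit meets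
the cross section. -/
structure Flow.IsCrossSection [MeasurableSpace X] [MeasurableSpace Z] [MeasurableSpace ι]
    (φ : Flow ℝ X) (p : Z → X) (c : Z → ι) (ε : ℝ) : Prop where
  measurable_pos : Measurable p
  measurable_color : Measurable c
  pos : 0 < ε
  inj : ∀ (z z' : Z) (t : ℝ), c z = c z' → |t| < ε → p z' = φ t (p z) → t = 0 ∧ z = z'
  surj : ∀ x, ∃ (z : Z) (t : ℝ), φ t (p z) = x

/-- The measures `μ` on the space and `m` on the cross section correspond to each other: the
sweeping map carries `m × Lebesgue` to `μ` on the sets where it is injective. -/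
def Flow.Corresponds [MeasurableSpace X] [MeasurableSpace Z] (φ : Flow ℝ X) (p : Z → X)
    (μ : Measure X) (m : Measure Z) : Prop :=
  ∀ C : Set (Z × ℝ), MeasurableSet C → InjOn (φ.sweep p) C →
    μ (φ.sweep p '' C) = (m.prod volume) C

/-- The measure `m` on the cross section is invariant under the partial Borel isomorphisms which
move points inside their orbits. -/
def Flow.HolonomyInvariant [MeasurableSpace Z] (φ : Flow ℝ X) (p : Z → X) (m : Measure Z) : Prop :=
  ∀ (C : Set Z) (g : Z → Z), MeasurableSet C → Measurable g → InjOn g C →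
    (∀ z ∈ C, p (g z) ∈ φ.orbit (p z)) → m (g '' C) = m C

namespace Flow

variable {φ : Flow ℝ X} {p : Z → X} {c : Z → ι} {ε : ℝ}

theorem sweep_shift (z : Z) (s t : ℝ) : φ.sweep p (z, t + s) = φ t (φ.sweep p (z, s)) :=
  φ.map_add _ _ _

theorem eq_iff_apply_neg (t : ℝ) (x y : X) : φ t x = y ↔ x = φ (-t) y := by
  constructor
  · rintro rfl
    rw [← φ.map_add, neg_add_cancel, φ.map_zero_apply]
  · rintro rfl
    rw [← φ.map_add, add_neg_cancel, φ.map_zero_apply]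

theorem sweep_eq_sweep_iff {w w' : Z × ℝ} :
    φ.sweep p w = φ.sweep p w' ↔ φ (w.2 - w'.2) (p w.1) = p w'.1 := by
  rw [sub_eq_neg_add, φ.map_add, eq_iff_apply_neg, neg_neg]
  rfl

/-- The piece of `Z × ℝ` which contains a point: its colour and a bounded interval of times. -/
noncomputable def boxIndex (c : Z → ι) (ε : ℝ) (w : Z × ℝ) : ι × ℤ := (c w.1, ⌊w.2 / ε⌋)

variable [MeasurableSpace X] [MeasurableSpace Z] [MeasurableSpace ι]

namespace IsCrossSection

theorem injOn_of_abs_sub_lt (h : φ.IsCrossSection p c ε) {C : Set (Z × ℝ)}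
    (hC : ∀ w ∈ C, ∀ w' ∈ C, c w.1 = c w'.1 ∧ |w.2 - w'.2| < ε) : InjOn (φ.sweep p) C := by
  intro w hw w' hw' he
  obtain ⟨h1, h2⟩ := hC w hw w' hw'
  obtain ⟨h3, h4⟩ := h.inj _ _ _ h1 h2 (sweep_eq_sweep_iff.1 he).symm
  exact Prod.ext h4 (sub_eq_zero.1 h3)

theorem abs_sub_lt (h : φ.IsCrossSection p c ε) {w w' : Z × ℝ}
    (hw : boxIndex c ε w = boxIndex c ε w') : |w.2 - w'.2| < ε := by
  have := Int.abs_sub_lt_one_of_floor_eq_floor (congrArg Prod.snd hw)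
  rwa [← sub_div, abs_div, abs_of_pos h.pos, div_lt_one h.pos] at this

/-- A box has a single colour and a half-open time interval of length `ε`. The countably many boxes
partition `Z × ℝ`. -/
theorem injOn_box (h : φ.IsCrossSection p c ε) (k : ι × ℤ) :
    InjOn (φ.sweep p) (boxIndex c ε ⁻¹' {k}) :=
  h.injOn_of_abs_sub_lt fun w hw w' hw' =>
    have e : boxIndex c ε w = boxIndex c ε w' := hw.trans hw'.symm
    ⟨congrArg Prod.fst e, h.abs_sub_lt e⟩

theorem measurable_boxIndex (h : φ.IsCrossSection p c ε) : Measurable (boxIndex c ε) :=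
  (h.measurable_color.comp measurable_fst).prodMk
    (Int.measurable_floor.comp (measurable_snd.div_const ε))

theorem measurableSet_box [Countable ι] [DiscreteMeasurableSpace ι] (h : φ.IsCrossSection p c ε)
    (k : ι × ℤ) : MeasurableSet (boxIndex c ε ⁻¹' {k}) :=
  h.measurable_boxIndex (measurableSet_singleton k)

variable [BorelSpace X] [PolishSpace X]

theorem measurable_sweep (h : φ.IsCrossSection p c ε) : Measurable (φ.sweep p) :=
  φ.cont'.measurable.comp (measurable_snd.prodMk (h.measurable_pos.comp measurable_fst))

/-- The part of `S` above `A` is swept bijectively onto `A`, so `m` determines `μ`. -/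
theorem apply_eq_of_corresponds {μ : Measure X} {m : Measure Z} (hs : φ.IsCrossSection p c ε)
    (hm : φ.Corresponds p μ m) {S : Set (Z × ℝ)} (hS : MeasurableSet S)
    (hiS : InjOn (φ.sweep p) S) (hSu : φ.sweep p '' S = univ) {A : Set X} (hA : MeasurableSet A) :
    μ A = (m.prod volume) (φ.sweep p ⁻¹' A ∩ S) := by
  rw [← hm _ ((hs.measurable_sweep hA).inter hS) (hiS.mono inter_subset_right),
    image_preimage_inter, hSu, inter_univ]

variable [StandardBorelSpace Z] [Countable ι] [DiscreteMeasurableSpace ι]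

theorem measurableSet_sweep_box (h : φ.IsCrossSection p c ε) (k : ι × ℤ) :
    MeasurableSet (φ.sweep p '' (boxIndex c ε ⁻¹' {k})) :=
  (h.measurableSet_box k).image_of_measurable_injOn h.measurable_sweep (h.injOn_box k)

/-- The orbit equivalence relation on a cross section is the union of countably many graphs of
injective Borel maps, with Borel transition times. -/
theorem exists_holonomy_maps [Nonempty Z] (hs : φ.IsCrossSection p c ε) :
    ∃ (h : (ι × ℤ) × ι → Z → Z) (σ : (ι × ℤ) × ι → Z → ℝ) (D : (ι × ℤ) × ι → Set Z),
      (∀ k, Measurable (h k)) ∧ (∀ k, Measurable (σ k)) ∧ (∀ k, MeasurableSet (D k)) ∧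
      (∀ k, InjOn (h k) (D k)) ∧ (∀ k, ∀ z ∈ D k, ∀ z' ∈ D k, c z = c z') ∧
      (∀ k, ∀ z ∈ D k, φ (σ k z) (p (h k z)) = p z) ∧
      ∀ z z' t, φ t (p z') = p z → ∃ k, z ∈ D k ∧ h k z = z' ∧ σ k z = t := by
  choose R hR hRP using fun k : ι × ℤ => exists_measurable_leftInverse_on hs.measurable_sweep
    (hs.measurableSet_box k) (hs.injOn_box k)
  have hD : ∀ (k : ι × ℤ) (z : Z), p z ∈ φ.sweep p '' (boxIndex c ε ⁻¹' {k}) →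
      boxIndex c ε (R k (p z)) = k ∧ φ.sweep p (R k (p z)) = p z := by
    rintro k z ⟨w, hw, he⟩
    rw [← he, hRP k w hw]
    exact ⟨hw, rfl⟩
  -- If `p z` lies in the image of a box, the inverse on that box writes it as `φ s (p z')`; then `h
  -- k z = z'` and `σ k z = s`. Fixing the colour of `z` as well makes `h k` injective: two points
  -- of `D k` with the same `z'` differ by a time less than `ε`.
  refine ⟨fun k z => (R k.1 (p z)).1, fun k z => (R k.1 (p z)).2,
    fun k => p ⁻¹' (φ.sweep p '' (boxIndex c ε ⁻¹' {k.1})) ∩ c ⁻¹' {k.2},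
    fun k => measurable_fst.comp ((hR k.1).comp hs.measurable_pos),
    fun k => measurable_snd.comp ((hR k.1).comp hs.measurable_pos),
    fun k => (hs.measurable_pos (hs.measurableSet_sweep_box k.1)).inter
      (hs.measurable_color (measurableSet_singleton k.2)), ?_, ?_, ?_, ?_⟩
  · rintro k z ⟨hz, hcz⟩ z' ⟨hz', hcz'⟩ he
    obtain ⟨h1, h2⟩ := hD _ z hz
    obtain ⟨h1', h2'⟩ := hD _ z' hz'
    have he' : (R k.1 (p z)).1 = (R k.1 (p z')).1 := he
    refine (hs.inj z z' ((R k.1 (p z')).2 - (R k.1 (p z)).2) (hcz.trans hcz'.symm)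
      (hs.abs_sub_lt (h1'.trans h1.symm)) ?_).2
    have e : φ ((R k.1 (p z')).2 - (R k.1 (p z)).2) (φ.sweep p (R k.1 (p z))) =
        φ.sweep p (R k.1 (p z')) := by
      rw [Flow.sweep, ← φ.map_add, sub_add_cancel, he', Flow.sweep]
    rw [h2, h2'] at e
    exact e.symm
  · rintro k z ⟨-, hz⟩ z' ⟨-, hz'⟩
    exact hz.trans hz'.symm
  · rintro k z ⟨hz, -⟩
    exact (hD _ z hz).2
  · intro z z' t he
    have := hRP (boxIndex c ε (z', t)) (z', t) rfl
    rw [show φ.sweep p (z', t) = p z from he] at this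
    refine ⟨(boxIndex c ε (z', t), c z), ⟨⟨(z', t), rfl, he⟩, rfl⟩, ?_, ?_⟩
    · simp only [this]
    · simp only [this]

/-- A transverse measure of a measure on the space is holonomy invariant. -/
theorem holonomyInvariant_of_corresponds (hs : φ.IsCrossSection p c ε) {μ : Measure X}
    {m : Measure Z} [IsFiniteMeasure m] (hm : φ.Corresponds p μ m) : φ.HolonomyInvariant p m := by
  intro C g hC hg hinj horb
  rcases isEmpty_or_nonempty Z with hZ | hZ
  · simp [Set.eq_empty_of_isEmpty]
  obtain ⟨h, σ, D, hh, hσ, hD, hhD, hcD, hp, hcov⟩ := hs.exists_holonomy_maps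
  refine measure_image_eq_of_countable_cover hg hC hinj m m
    (fun k => D k ∩ {z | h k z = g z}) (fun k => (hD k).inter (measurableSet_eq_fun (hh k) hg))
    ?_ ?_
  · intro z hz
    obtain ⟨t, ht⟩ := horb z hz
    obtain ⟨k, h1, h2, -⟩ := hcov z (g z) (-t) ((eq_iff_apply_neg t _ _).1 ht).symm
    exact mem_iUnion.2 ⟨k, h1, h2⟩
  · intro k A hA hAS
    have hAD : A ⊆ D k := fun z hz => (hAS hz).2.1
    -- Here `m'` is `m` pulled back by `h k`. The skew map by `h k` and `σ k` does not change the
    -- swept point, so the image of `A × [0, ε)` has measure `ε * m A` by correspondence with `μ`,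
    -- and `ε * m' A` by the skew product formula.
    obtain ⟨m', hm'1, hm'⟩ := exists_measure_eq_image (hh k) (hD k) (hhD k) m
    have : IsFiniteMeasure m' := ⟨hm'1.trans_lt (measure_lt_top m _)⟩
    have hAI := hA.prod (measurableSet_Ico (a := (0 : ℝ)) (b := ε))
    have hAID : A ×ˢ Ico 0 ε ⊆ D k ×ˢ univ := prod_mono hAD (subset_univ _)
    have e1 := prod_volume_skew_image m' m (hh k) (hσ k) (hD k) (hhD k)
      (fun B hB hBD => by rw [hm' B hB, inter_eq_left.2 hBD]) hAI hAID
    have hsw : EqOn (φ.sweep p ∘ fun w => (h k w.1, w.2 + σ k w.1)) (φ.sweep p) (A ×ˢ Ico 0 ε) := by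
      rintro ⟨z, s⟩ hw
      rw [Function.comp_apply, sweep_shift, Flow.sweep, hp k z (hAD hw.1)]
      rfl
    have hinjA : InjOn (φ.sweep p) (A ×ˢ Ico 0 ε) := hs.injOn_of_abs_sub_lt fun w hw w' hw' =>
      ⟨hcD k _ (hAD hw.1) _ (hAD hw'.1), abs_sub_lt_of_mem_Ico hw.2 hw'.2⟩
    have hskm : Measurable fun w : Z × ℝ => (h k w.1, w.2 + σ k w.1) :=
      ((hh k).comp measurable_fst).prodMk (measurable_snd.add ((hσ k).comp measurable_fst))
    have hinjH := (hinjA.congr hsw.symm).image_of_comp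
    have e2 := hm _ (hAI.image_of_measurable_injOn hskm (hinjA.congr hsw.symm).of_comp) hinjH
    rw [← image_comp, hsw.image_eq, hm _ hAI hinjA, e1, Measure.prod_prod, Measure.prod_prod,
      hm' A hA, inter_eq_left.2 hAD, Real.volume_Ico, sub_zero] at e2
    have hε0 : ENNReal.ofReal ε ≠ 0 := by simpa using hs.pos
    rw [← image_congr (fun z hz => (hAS hz).2.2)]
    exact ((ENNReal.mul_left_inj hε0 ENNReal.ofReal_ne_top).1 e2).symm

/-- For a holonomy invariant measure `m`, the measure `m × Lebesgue` of a set on which the sweeping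
map is injective depends only on the image of the set. -/
theorem prod_volume_eq_of_sweep_image_eq (hs : φ.IsCrossSection p c ε) {m : Measure Z}
    [IsFiniteMeasure m] (hm : φ.HolonomyInvariant p m) {C C' : Set (Z × ℝ)} (hC : MeasurableSet C)
    (hC' : MeasurableSet C') (hi : InjOn (φ.sweep p) C) (hi' : InjOn (φ.sweep p) C')
    (he : φ.sweep p '' C = φ.sweep p '' C') : (m.prod volume) C = (m.prod volume) C' := by
  rcases isEmpty_or_nonempty Z with hZ | hZ
  · simp [Set.eq_empty_of_isEmpty]
  obtain ⟨h, σ, D, hh, hσ, hD, hhD, hcD, hp, hcov⟩ := hs.exists_holonomy_maps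
  obtain ⟨R, hR, hRP⟩ := exists_measurable_leftInverse_on hs.measurable_sweep hC' hi'
  have hG : ∀ w ∈ C, R (φ.sweep p w) ∈ C' ∧ φ.sweep p (R (φ.sweep p w)) = φ.sweep p w := by
    intro w hw
    obtain ⟨w', hw', e⟩ := he ▸ mem_image_of_mem (φ.sweep p) hw
    rw [← e, hRP w' hw']
    exact ⟨hw', rfl⟩
  have hGm : Measurable (R ∘ φ.sweep p) := hR.comp hs.measurable_sweep
  have hGC : (R ∘ φ.sweep p) '' C = C' := by
    refine Subset.antisymm (image_subset_iff.2 fun w hw => (hG w hw).1) fun w' hw' => ?_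
    obtain ⟨w, hw, e⟩ := he.symm ▸ mem_image_of_mem (φ.sweep p) hw'
    exact ⟨w, hw, by rw [Function.comp_apply, e, hRP w' hw']⟩
  have hGi : InjOn (R ∘ φ.sweep p) C := fun w hw w' hw' e =>
    hi hw hw' (by rw [← (hG w hw).2, ← (hG w' hw').2]; exact congrArg _ e)
  have hskm : ∀ k, Measurable fun w : Z × ℝ => (h k w.1, w.2 + σ k w.1) := fun k =>
    ((hh k).comp measurable_fst).prodMk (measurable_snd.add ((hσ k).comp measurable_fst))
  rw [← hGC]
  -- The bijection `R ∘ φ.sweep p` from `C` to `C'` moves points inside the fibres of the sweeping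
  -- map, so on each piece it is one of the skew holonomy maps, and these preserve `m × Lebesgue`.
  refine (measure_image_eq_of_countable_cover hGm hC hGi (m.prod volume) (m.prod volume)
    (fun k => D k ×ˢ univ ∩ {w | (h k w.1, w.2 + σ k w.1) = (R ∘ φ.sweep p) w})
    (fun k => ((hD k).prod .univ).inter (measurableSet_eq_fun (hskm k) hGm)) ?_ ?_).symm
  · intro w hw
    obtain ⟨k, h1, h2, h3⟩ := hcov w.1 _ _ (sweep_eq_sweep_iff.1 (hG w hw).2)
    refine mem_iUnion.2 ⟨k, ⟨h1, trivial⟩, Prod.ext h2 ?_⟩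
    simp [h3]
  · intro k A hA hAS
    rw [← image_congr (fun w hw => (hAS hw).2.2)]
    refine prod_volume_skew_image m m (hh k) (hσ k) (hD k) (hhD k) (fun B hB hBD => ?_) hA
      fun w hw => (hAS hw).2.1
    exact hm B (h k) hB (hh k) ((hhD k).mono hBD) fun z hz =>
      ⟨-σ k z, ((eq_iff_apply_neg _ _ _).1 (hp k z (hBD hz))).symm⟩

/-- There is a Borel set in `Z × ℝ` which the sweeping map carries bijectively to the space. -/
theorem exists_section (hs : φ.IsCrossSection p c ε) :
    ∃ S : Set (Z × ℝ), MeasurableSet S ∧ InjOn (φ.sweep p) S ∧ φ.sweep p '' S = univ := by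
  obtain ⟨e, he⟩ := exists_injective_nat (ι × ℤ)
  let B : ι × ℤ → Set X := fun k => φ.sweep p '' (boxIndex c ε ⁻¹' {k})
  -- Boxes are numbered by `e`; for each point of the space, only its preimage in the lowest
  -- numbered box that covers it is kept.
  refine ⟨⋂ k, {w | e k < e (boxIndex c ε w) → φ.sweep p w ∉ B k}, ?_, ?_, ?_⟩
  · refine MeasurableSet.iInter fun k => ?_
    have h1 : MeasurableSet {w : Z × ℝ | e k < e (boxIndex c ε w)} :=
      hs.measurable_boxIndex (MeasurableSet.of_discrete (s := {k' | e k < e k'}))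
    exact h1.imp (hs.measurable_sweep (hs.measurableSet_sweep_box k)).compl
  · have key : ∀ w w' : Z × ℝ, (w' ∈ ⋂ k, {w | e k < e (boxIndex c ε w) → φ.sweep p w ∉ B k}) →
        φ.sweep p w = φ.sweep p w' → e (boxIndex c ε w') ≤ e (boxIndex c ε w) := by
      intro w w' hw' h
      by_contra! hlt
      exact mem_iInter.1 hw' (boxIndex c ε w) hlt ⟨w, rfl, h⟩
    intro w hw w' hw' h
    exact hs.injOn_box _ (he ((key w' w hw h.symm).antisymm (key w w' hw' h))) rfl h
  · refine eq_univ_of_forall fun x => ?_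
    have hex : ∃ j, ∃ w, e (boxIndex c ε w) = j ∧ φ.sweep p w = x := by
      obtain ⟨z, t, h⟩ := hs.surj x
      exact ⟨_, (z, t), rfl, h⟩
    classical
    obtain ⟨w, h1, h2⟩ := Nat.find_spec hex
    refine ⟨w, mem_iInter.2 fun k hk hx => ?_, h2⟩
    obtain ⟨w', hw', h3⟩ := hx
    rw [h1] at hk
    exact Nat.find_min hex hk ⟨w', congrArg e hw', h3.trans h2⟩

/-- A holonomy invariant measure on a cross section corresponds to a measure on the space. -/
theorem exists_corresponds_of_holonomyInvariant (hs : φ.IsCrossSection p c ε) {m : Measure Z}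
    [IsFiniteMeasure m] (hm : φ.HolonomyInvariant p m) : ∃ μ : Measure X, φ.Corresponds p μ m := by
  obtain ⟨S, hS, hiS, hSu⟩ := hs.exists_section
  refine ⟨((m.prod volume).restrict S).map (φ.sweep p), fun C hC hi => ?_⟩
  have hCm := hC.image_of_measurable_injOn hs.measurable_sweep hi
  have hpre := hs.measurable_sweep hCm
  rw [Measure.map_apply hs.measurable_sweep hCm, Measure.restrict_apply hpre]
  refine hs.prod_volume_eq_of_sweep_image_eq hm (hpre.inter hS) hC
    (hiS.mono inter_subset_right) hi ?_
  rw [image_preimage_inter, hSu, inter_univ]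

theorem corresponds_unique_left (hs : φ.IsCrossSection p c ε) {μ μ' : Measure X} {m : Measure Z}
    (h : φ.Corresponds p μ m) (h' : φ.Corresponds p μ' m) : μ = μ' := by
  obtain ⟨S, hS, hiS, hSu⟩ := hs.exists_section
  ext A hA
  rw [hs.apply_eq_of_corresponds h hS hiS hSu hA, hs.apply_eq_of_corresponds h' hS hiS hSu hA]

/-- Under the sweeping map, `φ t` lifts to the time translation by `t`, which preserves `m ×
Lebesgue`. -/
theorem isInvariantMeasure_of_corresponds (hs : φ.IsCrossSection p c ε) {μ : Measure X}
    {m : Measure Z} [IsFiniteMeasure m] (hm : φ.Corresponds p μ m) : φ.IsInvariantMeasure μ := by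
  intro t A hA
  obtain ⟨S, hS, hiS, hSu⟩ := hs.exists_section
  have hC := (hs.measurable_sweep hA).inter hS
  have hiC : InjOn (φ.sweep p) (φ.sweep p ⁻¹' A ∩ S) := hiS.mono inter_subset_right
  have hcomp : φ.sweep p ∘ (fun w : Z × ℝ => (w.1, t + w.2)) = φ t ∘ φ.sweep p :=
    funext fun w => sweep_shift w.1 w.2 t
  have hφi : Function.Injective (φ t) := fun x y h =>
    ((eq_iff_apply_neg t x _).1 h).trans ((eq_iff_apply_neg t y _).1 rfl).symm
  have hiT := (hcomp ▸ hφi.injOn.comp hiC (mapsTo_univ _ _) :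
    InjOn (φ.sweep p ∘ (fun w : Z × ℝ => (w.1, t + w.2))) _)
  have hT : MeasurePreserving (fun w : Z × ℝ => (w.1, t + w.2)) (m.prod volume) (m.prod volume) :=
    (MeasurePreserving.id m).skew_product (g := fun _ s => t + s) (by fun_prop)
      (Filter.Eventually.of_forall fun _ => map_add_left_eq_self volume t)
  have hTi : Function.Injective (fun w : Z × ℝ => (w.1, t + w.2)) := by
    rintro ⟨z, s⟩ ⟨z', s'⟩ h
    simpa using h
  have hTC := hC.image_of_measurable_injOn hT.measurable hTi.injOn
  have e := hm _ hTC hiT.image_of_comp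
  rw [← image_comp, hcomp, image_comp, image_preimage_inter, hSu, inter_univ,
    ← hT.measure_preimage hTC.nullMeasurableSet, hTi.preimage_image] at e
  rw [e, ← hs.apply_eq_of_corresponds hm hS hiS hSu hA]

/-- A finite invariant measure corresponds to a finite measure on the cross section. -/
theorem exists_corresponds_of_isInvariantMeasure [Finite ι] (hs : φ.IsCrossSection p c ε)
    {μ : Measure X} [IsFiniteMeasure μ] (hμ : φ.IsInvariantMeasure μ) :
    ∃ m : Measure Z, IsFiniteMeasure m ∧ φ.Corresponds p μ m := by
  rcases isEmpty_or_nonempty Z with hZ | hZ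
  · refine ⟨0, inferInstance, fun C _ _ => ?_⟩
    simp [Set.eq_empty_of_isEmpty C]
  let B : ι × ℤ → Set (Z × ℝ) := fun k => boxIndex c ε ⁻¹' {k}
  have hBd : Pairwise (Function.onFun Disjoint B) := fun k l hkl =>
    Disjoint.preimage _ (disjoint_singleton.2 hkl)
  have hBu : ∀ C : Set (Z × ℝ), C = ⋃ k, C ∩ B k := fun C => by
    rw [← inter_iUnion]
    exact (inter_eq_left.2 fun w _ => mem_iUnion.2 ⟨boxIndex c ε w, rfl⟩).symm
  have hCd : ∀ C : Set (Z × ℝ), Pairwise (Function.onFun Disjoint fun k => C ∩ B k) :=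
    fun C k l hkl => (hBd hkl).mono inter_subset_right inter_subset_right
  have hsplit : ∀ (N : Measure (Z × ℝ)) (C : Set (Z × ℝ)), MeasurableSet C →
      N C = ∑' k, N (C ∩ B k) := fun N C hC => by
    conv_lhs => rw [hBu C]
    exact measure_iUnion (hCd C) fun k => hC.inter (hs.measurableSet_box k)
  choose N₀ hN₀ hN using fun k : ι × ℤ => exists_measure_eq_image hs.measurable_sweep
    (hs.measurableSet_box k) (hs.injOn_box k) μ
  -- `N` is `μ` pulled back box by box, so it counts a set with multiplicity and agrees with `μ` of
  -- the image wherever the sweeping map is injective.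
  let N : Measure (Z × ℝ) := Measure.sum N₀
  have hNi : ∀ C, MeasurableSet C → InjOn (φ.sweep p) C → N C = μ (φ.sweep p '' C) := by
    intro C hC hi
    rw [Measure.sum_apply _ hC]
    conv_rhs => rw [hBu C, image_iUnion]
    rw [measure_iUnion]
    · exact tsum_congr fun k => hN k C hC
    · intro k l hkl
      rw [Function.onFun, disjoint_iff_inter_eq_empty,
        ← hi.image_inter inter_subset_left inter_subset_left, (hCd C hkl).inter_eq, image_empty]
    · exact fun k => (hC.inter (hs.measurableSet_box k)).image_of_measurable_injOn
        hs.measurable_sweep ((hs.injOn_box k).mono inter_subset_right)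
  have htr : ∀ t : ℝ, Measurable (fun w : Z × ℝ => (w.1, t + w.2)) := fun t => by fun_prop
  have htrans : ∀ (t : ℝ) (C : Set (Z × ℝ)), MeasurableSet C → InjOn (φ.sweep p) C →
      N ((fun w => (w.1, t + w.2)) ⁻¹' C) = N C := by
    intro t C hC hi
    have hcomp : φ.sweep p ∘ (fun w : Z × ℝ => (w.1, t + w.2)) = φ t ∘ φ.sweep p :=
      funext fun w => sweep_shift w.1 w.2 t
    have hsurj : Function.Surjective (fun w : Z × ℝ => (w.1, t + w.2)) := fun w =>
      ⟨(w.1, -t + w.2), by simp⟩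
    have hinj : Function.Injective (fun w : Z × ℝ => (w.1, t + w.2)) := by
      rintro ⟨z, s⟩ ⟨z', s'⟩ h
      simpa using h
    have hi' : InjOn (φ.sweep p) ((fun w => (w.1, t + w.2)) ⁻¹' C) := by
      have := hi.comp (hinj.injOn (s := (fun w : Z × ℝ => (w.1, t + w.2)) ⁻¹' C))
        (mapsTo_preimage _ _)
      rw [hcomp] at this
      exact this.of_comp
    have hm := (htr t hC).image_of_measurable_injOn hs.measurable_sweep hi'
    rw [hNi _ (htr t hC) hi', hNi C hC hi, ← hμ t _ hm, ← image_comp, ← hcomp, image_comp,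
      image_preimage_eq C hsurj]
  -- Sweeping is injective on one colour over `[0, ε)`, and there are finitely many colours.
  have hfin : N (univ ×ˢ Ico 0 ε) ≠ ⊤ := by
    have hu : (univ ×ˢ Ico 0 ε : Set (Z × ℝ)) = ⋃ i, (c ⁻¹' {i}) ×ˢ Ico 0 ε := by
      rw [← iUnion_prod_const]
      congr 1
      exact (eq_univ_of_forall fun z => mem_iUnion.2 ⟨c z, rfl⟩).symm
    have := Fintype.ofFinite ι
    rw [hu, ← lt_top_iff_ne_top]
    refine (measure_iUnion_le _).trans_lt ?_
    rw [tsum_fintype]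
    refine ENNReal.sum_lt_top.2 fun i _ => ?_
    rw [hNi]
    · exact measure_lt_top _ _
    · exact (hs.measurable_color (measurableSet_singleton i)).prod measurableSet_Ico
    · exact hs.injOn_of_abs_sub_lt fun w hw w' hw' =>
        ⟨hw.1.trans hw'.1.symm, abs_sub_lt_of_mem_Ico hw.2 hw'.2⟩
  -- Translation does not respect the boxes, but the translate of a part of a box is still a set
  -- where sweeping is injective.
  have hinv : ∀ (t : ℝ) (C : Set (Z × ℝ)), MeasurableSet C →
      N ((fun w => (w.1, t + w.2)) ⁻¹' C) = N C := by
    intro t C hC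
    conv_lhs => rw [hBu C, preimage_iUnion]
    rw [hsplit N C hC, measure_iUnion]
    · exact tsum_congr fun k => htrans t _ (hC.inter (hs.measurableSet_box k))
        ((hs.injOn_box k).mono inter_subset_right)
    · exact fun k l hkl => (hCd C hkl).preimage _
    · exact fun k => htr t (hC.inter (hs.measurableSet_box k))
  obtain ⟨m, hmf, hNm⟩ := exists_prod_volume_of_translation_invariant N hs.pos hfin hinv
  exact ⟨m, hmf, fun C hC hi => by rw [← hNm, hNi C hC hi]⟩

end IsCrossSection

end Flow

end CrossSections

/-! ### Flow boxes and the disjoint union of transversals as a cross section. -/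

section Transversals

variable {X Y : Type*}

theorem Flow.IsFlowBox.eq_of_apply_eq [TopologicalSpace X] {φ : Flow ℝ X} {U T : Set X} {ε : ℝ}
    (h : φ.IsFlowBox U T ε) {x y : X} (hx : x ∈ T) (hy : y ∈ T) {s t : ℝ} (hs : s ∈ Ioo (-ε) ε)
    (ht : t ∈ Ioo (-ε) ε) (he : φ s x = φ t y) : x = y ∧ s = t := by
  obtain ⟨Φ, hΦ⟩ := h.homeo
  have := Φ.injective (a₁ := (⟨x, hx⟩, ⟨s, hs⟩)) (a₂ := (⟨y, hy⟩, ⟨t, ht⟩))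
    (Subtype.ext (by rw [hΦ, hΦ]; exact he))
  simpa using this

theorem Flow.IsFlowBox.exists_apply_eq [TopologicalSpace X] {φ : Flow ℝ X} {U T : Set X} {ε : ℝ}
    (h : φ.IsFlowBox U T ε) {u : X} (hu : u ∈ U) : ∃ x ∈ T, ∃ s ∈ Ioo (-ε) ε, φ s x = u := by
  obtain ⟨Φ, hΦ⟩ := h.homeo
  obtain ⟨⟨x, s⟩, hxs⟩ := Φ.surjective ⟨u, hu⟩
  exact ⟨x, x.2, s, s.2, by rw [← hΦ, hxs]⟩

theorem Flow.IsTransversal.measurableSet [TopologicalSpace X] [MeasurableSpace X] [BorelSpace X]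
    {φ : Flow ℝ X} {T : Set X} (h : φ.IsTransversal T) : MeasurableSet T := by
  obtain ⟨U, ε, hU⟩ := h
  have := hU.isOpen.measurableSet.subtype_image hU.isClosed.measurableSet
  rwa [show ((↑) : U → X) '' {u : U | (u : X) ∈ T} = T from ?_] at this
  ext x
  constructor
  · rintro ⟨u, hu, rfl⟩
    exact hu
  · exact fun hx => ⟨⟨x, hU.subset hx⟩, hx, rfl⟩

variable {n : ℕ} {T : Fin n → Set X} {T' : Fin n → Set Y}

/-- The disjoint union of a family of subsets. -/
abbrev DisjointUnion (T : Fin n → Set X) : Type _ := {z : Fin n × X // z.2 ∈ T z.1}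

namespace DisjointUnion

/-- The inclusion of a member of the family in the disjoint union. -/
def incl (T : Fin n → Set X) (i : Fin n) (x : T i) : DisjointUnion T := ⟨(i, x), x.2⟩

/-- The underlying point of a point of the disjoint union. -/
def point (z : DisjointUnion T) : X := z.1.2

/-- The index of a point of the disjoint union. -/
def index (z : DisjointUnion T) : Fin n := z.1.1

theorem incl_injective (i : Fin n) : Function.Injective (incl T i) := fun _ _ h =>
  Subtype.ext (congrArg point h)

theorem exists_incl (z : DisjointUnion T) : ∃ i x, incl T i x = z := ⟨z.1.1, ⟨z.1.2, z.2⟩, rfl⟩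

/-- The bijection of disjoint unions defined by bijections of their members. -/
def congr (F : ∀ i, T i ≃ T' i) : DisjointUnion T ≃ DisjointUnion T' where
  toFun z := incl T' z.1.1 (F z.1.1 ⟨z.1.2, z.2⟩)
  invFun z := incl T z.1.1 ((F z.1.1).symm ⟨z.1.2, z.2⟩)
  left_inv z := by
    obtain ⟨i, x, rfl⟩ := exists_incl z
    exact congrArg (incl T i) ((F i).symm_apply_apply x)
  right_inv z := by
    obtain ⟨i, x, rfl⟩ := exists_incl z
    exact congrArg (incl T' i) ((F i).apply_symm_apply x)

theorem congr_incl (F : ∀ i, T i ≃ T' i) (i : Fin n) (x : T i) :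
    congr F (incl T i x) = incl T' i (F i x) := rfl

theorem congr_preimage_image_incl (F : ∀ i, T i ≃ T' i) (i : Fin n) (B : Set (T' i)) :
    congr F ⁻¹' (incl T' i '' B) = incl T i '' (F i ⁻¹' B) := by
  ext z
  constructor
  · rintro ⟨y, hy, h⟩
    refine ⟨(F i).symm y, by simpa using hy, (congr F).injective ?_⟩
    rw [congr_incl, Equiv.apply_symm_apply, h]
  · rintro ⟨x, hx, rfl⟩
    exact ⟨F i x, hx, rfl⟩

theorem eq_iUnion_image_incl (A : Set (DisjointUnion T)) :
    A = ⋃ i, incl T i '' (incl T i ⁻¹' A) := by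
  ext z
  obtain ⟨i, x, rfl⟩ := exists_incl z
  constructor
  · exact fun h => mem_iUnion.2 ⟨i, x, h, rfl⟩
  · intro h
    obtain ⟨j, y, hy, e⟩ := mem_iUnion.1 h
    exact e ▸ hy

variable [MeasurableSpace X] [MeasurableSpace Y]

theorem measurable_incl (i : Fin n) : Measurable (incl T i) :=
  (measurable_const.prodMk measurable_subtype_coe).subtype_mk

theorem measurable_point : Measurable (point : DisjointUnion T → X) :=
  measurable_snd.comp measurable_subtype_coe

theorem measurable_index : Measurable (index : DisjointUnion T → Fin n) :=
  measurable_fst.comp measurable_subtype_coe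

theorem standardBorelSpace [StandardBorelSpace X] (hT : ∀ i, MeasurableSet (T i)) :
    StandardBorelSpace (DisjointUnion T) := by
  suffices h : MeasurableSet {z : Fin n × X | z.2 ∈ T z.1} from h.standardBorel
  have : {z : Fin n × X | z.2 ∈ T z.1} = ⋃ i, {i} ×ˢ T i := by
    ext z
    simp
  rw [this]
  exact MeasurableSet.iUnion fun i => (measurableSet_singleton i).prod (hT i)

theorem measurableSet_image_incl [StandardBorelSpace X] (hT : ∀ i, MeasurableSet (T i)) {i : Fin n}
    {A : Set (T i)} (hA : MeasurableSet A) : MeasurableSet (incl T i '' A) := by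
  have := standardBorelSpace hT
  have := (hT i).standardBorel
  exact hA.image_of_measurable_injOn (measurable_incl i) (incl_injective i).injOn

theorem measure_ext [StandardBorelSpace X] (hT : ∀ i, MeasurableSet (T i))
    {m m' : Measure (DisjointUnion T)}
    (h : ∀ i (A : Set (T i)), MeasurableSet A → m (incl T i '' A) = m' (incl T i '' A)) :
    m = m' := by
  ext A hA
  have hd : Pairwise (Function.onFun Disjoint fun i => incl T i '' (incl T i ⁻¹' A)) := by
    intro i j hij
    refine Set.disjoint_left.2 ?_
    rintro _ ⟨x, -, rfl⟩ ⟨y, -, h⟩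
    exact hij (congrArg index h).symm
  have hm := fun i => measurableSet_image_incl hT (measurable_incl i hA)
  rw [eq_iUnion_image_incl A, measure_iUnion hd hm, measure_iUnion hd hm]
  exact tsum_congr fun i => h i _ (measurable_incl i hA)

theorem measurable_congr [StandardBorelSpace X] (hT : ∀ i, MeasurableSet (T i))
    (F : ∀ i, T i ≃ T' i) (hF : ∀ i, Measurable (F i)) : Measurable (congr F) := by
  intro B hB
  rw [eq_iUnion_image_incl B, preimage_iUnion]
  refine MeasurableSet.iUnion fun i => ?_
  rw [congr_preimage_image_incl]
  exact measurableSet_image_incl hT (hF i (measurable_incl i hB))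

end DisjointUnion

open DisjointUnion

variable [TopologicalSpace X] [TopologicalSpace Y]

/-- The disjoint union of a complete family of transversals is a cross section. -/
theorem Flow.IsCompleteTransversals.exists_isCrossSection [MeasurableSpace X] {φ : Flow ℝ X}
    (hT : φ.IsCompleteTransversals T) :
    ∃ ε, φ.IsCrossSection (point : DisjointUnion T → X) (index : DisjointUnion T → Fin n) ε := by
  choose U e hU using hT.1
  -- A common lower bound for the box sizes; the filter argument also covers `n = 0`.
  obtain ⟨ε, hε, hε0⟩ : ∃ ε : ℝ, (∀ i, ε ≤ e i) ∧ 0 < ε := by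
    have h1 : ∀ᶠ ε in nhdsWithin (0 : ℝ) (Ioi 0), ∀ i, ε ≤ e i :=
      Filter.eventually_all.2 fun i =>
        Filter.mem_of_superset (Ioc_mem_nhdsGT (hU i).pos) fun x hx => hx.2
    exact (h1.and self_mem_nhdsWithin).exists
  refine ⟨ε, measurable_point, measurable_index, hε0, ?_, ?_⟩
  · intro z z' t hc ht he
    obtain ⟨i, x, rfl⟩ := exists_incl z
    obtain ⟨j, y, rfl⟩ := exists_incl z'
    obtain rfl : i = j := hc
    have h0 : (0 : ℝ) ∈ Ioo (-e i) (e i) := ⟨neg_neg_of_pos (hU i).pos, (hU i).pos⟩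
    have ht' : t ∈ Ioo (-e i) (e i) := abs_lt.1 (ht.trans_le (hε i))
    obtain ⟨h1, h2⟩ := (hU i).eq_of_apply_eq y.2 x.2 h0 ht' ((φ.map_zero_apply _).trans he)
    exact ⟨h2.symm, congrArg (incl T i) (Subtype.ext h1.symm)⟩
  · intro x
    obtain ⟨i, y, hy, t, ht⟩ := hT.2 x
    exact ⟨incl T i ⟨y, hy⟩, t, ht⟩

/-- Applying `φ (-t)` moves the time window to `(-ε, ε)`. Arbitrary centres `t` serve to cover the
whole space in `Flow.Corresponds.isFiniteMeasure`. -/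
theorem Flow.IsFlowBox.injOn_sweep {φ : Flow ℝ X} {U : Set X} {ε : ℝ} {i : Fin n}
    (h : φ.IsFlowBox U (T i) ε) (A : Set (T i)) (t : ℝ) :
    InjOn (φ.sweep (point : DisjointUnion T → X)) ((incl T i '' A) ×ˢ Ioo (t - ε) (t + ε)) := by
  rintro ⟨_, s⟩ ⟨⟨x, -, rfl⟩, hs⟩ ⟨_, s'⟩ ⟨⟨y, -, rfl⟩, hs'⟩ he
  have hI : ∀ r ∈ Ioo (t - ε) (t + ε), r - t ∈ Ioo (-ε) ε := fun r hr =>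
    ⟨by linarith [hr.1], by linarith [hr.2]⟩
  have he' : φ (s - t) (x : X) = φ (s' - t) (y : X) := by
    have := congrArg (φ (-t)) he
    simp only [Flow.sweep, ← φ.map_add, ← sub_eq_neg_add] at this
    exact this
  obtain ⟨h1, h2⟩ := h.eq_of_apply_eq x.2 y.2 (hI s hs) (hI s' hs') he'
  rw [Subtype.ext h1, sub_left_injective h2]

variable [MeasurableSpace X] [MeasurableSpace Y]

/-- The measure induced on a transversal is the restriction of the corresponding measure on the
cross section. -/
theorem Flow.Corresponds.transverseMeasure_eq [StandardBorelSpace X] {φ : Flow ℝ X}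
    (hT : ∀ i, MeasurableSet (T i)) {μ : Measure X} {m : Measure (DisjointUnion T)}
    [IsFiniteMeasure m] (hm : φ.Corresponds point μ m) {U : Set X} {ε : ℝ} {i : Fin n}
    (h : φ.IsFlowBox U (T i) ε) {A : Set (T i)} (hA : MeasurableSet A) :
    φ.transverseMeasure μ ε A = m (incl T i '' A) := by
  have hinj := h.injOn_sweep A 0
  rw [zero_sub, zero_add] at hinj
  have e := hm _ ((measurableSet_image_incl hT hA).prod measurableSet_Ioo) hinj
  have hset : {z : X | ∃ x ∈ A, ∃ s ∈ Ioo (-ε) ε, z = φ s x} =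
      φ.sweep (point : DisjointUnion T → X) '' ((incl T i '' A) ×ˢ Ioo (-ε) ε) := by
    ext z
    constructor
    · rintro ⟨x, hx, s, hs, rfl⟩
      exact ⟨(incl T i x, s), ⟨⟨x, hx, rfl⟩, hs⟩, rfl⟩
    · rintro ⟨⟨_, s⟩, ⟨⟨x, hx, rfl⟩, hs⟩, rfl⟩
      exact ⟨x, hx, s, hs, rfl⟩
  rw [Flow.transverseMeasure, hset, e, Measure.prod_prod, Real.volume_Ioo, sub_neg_eq_add,
    ← two_mul, ENNReal.mul_div_cancel_right _ ENNReal.ofReal_ne_top]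
  simpa using h.pos

/-- A flow box translated along the flow is a neighbourhood of a given point, of measure `2 * ε`
times the mass of its transversal; compactness then gives finiteness. -/
theorem Flow.Corresponds.isFiniteMeasure [CompactSpace X] [StandardBorelSpace X]
    {φ : Flow ℝ X} (hT : φ.IsCompleteTransversals T) (hTm : ∀ i, MeasurableSet (T i))
    {μ : Measure X} {m : Measure (DisjointUnion T)} [IsFiniteMeasure m]
    (hm : φ.Corresponds point μ m) : IsFiniteMeasure μ := by
  have : IsLocallyFiniteMeasure μ := ⟨fun x => by
    obtain ⟨i, y, hy, t, rfl⟩ := hT.2 x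
    obtain ⟨U, ε, hU⟩ := hT.1 i
    refine ⟨φ (-t) ⁻¹' U, (hU.isOpen.preimage (φ.continuous_toFun (-t))).mem_nhds ?_, ?_⟩
    · rw [mem_preimage]
      change φ (-t) (φ t y) ∈ U
      rw [← φ.map_add, neg_add_cancel, φ.map_zero_apply]
      exact hU.subset hy
    · have e := hm _ ((measurableSet_image_incl hTm MeasurableSet.univ).prod measurableSet_Ioo)
        (hU.injOn_sweep univ t)
      refine (measure_mono ?_).trans_lt (e.trans_lt ?_)
      · intro z hz
        obtain ⟨x, hx, s, hs, h⟩ := hU.exists_apply_eq hz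
        refine ⟨(incl T i ⟨x, hx⟩, t + s), ⟨⟨_, trivial, rfl⟩, ?_⟩, ?_⟩
        · exact ⟨by linarith [hs.1], by linarith [hs.2]⟩
        · rw [Flow.sweep_shift]
          change φ t (φ s x) = z
          rw [h, ← φ.map_add, add_neg_cancel, φ.map_zero_apply]
      · rw [Measure.prod_prod, Real.volume_Ioo]
        exact ENNReal.mul_lt_top (measure_lt_top m _) ENNReal.ofReal_lt_top⟩
  infer_instance

/-- A map preserving the holonomy carries holonomy invariant measures to holonomy invariant
measures. -/
theorem Flow.HolonomyInvariant.map_congr {φ : Flow ℝ X} {ψ : Flow ℝ Y}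
    {m : Measure (DisjointUnion T)} (hm : φ.HolonomyInvariant point m) (F : ∀ i, T i ≃ T' i)
    (hF : PreservesHolonomy φ ψ fun i => F i) (hFm : Measurable (congr F))
    (hFm' : Measurable (congr F).symm) : ψ.HolonomyInvariant point (m.map (congr F)) := by
  intro C g hC hg hinj horb
  let e : DisjointUnion T ≃ᵐ DisjointUnion T' := ⟨congr F, hFm, hFm'⟩
  change m.map e _ = m.map e _
  have hpre : e ⁻¹' (g '' C) = (e.symm ∘ g) '' C := by
    rw [image_comp]
    exact (e.symm.toEquiv.image_eq_preimage_symm _).symm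
  rw [e.map_apply, e.map_apply, hpre]
  -- Conjugation by `e` turns the partial holonomy `g` of `ψ` into one of `φ`.
  have himg : (e.symm ∘ g) '' C = (e.symm ∘ g ∘ e) '' (e ⁻¹' C) := by
    rw [← Function.comp_assoc, image_comp _ e, image_preimage_eq _ e.surjective]
  rw [himg]
  refine hm _ _ (e.measurable hC) (e.symm.measurable.comp (hg.comp e.measurable)) ?_ ?_
  · exact e.symm.injective.comp_injOn (hinj.comp e.injective.injOn (mapsTo_preimage _ _))
  · intro z hz
    have h := horb (e z) hz
    obtain ⟨i, x, rfl⟩ := exists_incl z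
    obtain ⟨j, y, hy⟩ := exists_incl (e.symm (g (e (incl T i x))))
    have hy' : g (e (incl T i x)) = e (incl T j y) := by rw [hy, e.apply_symm_apply]
    rw [hy'] at h
    rw [Function.comp_apply, Function.comp_apply, ← hy]
    exact (hF i j x y).2 h

end Transversals

/-! ### The bijection of invariant measures and unique ergodicity. -/

section Correspondence

open DisjointUnion

variable {X Y : Type*} {n : ℕ} {T : Fin n → Set X} {T' : Fin n → Set Y}

theorem PreservesHolonomy.symm [TopologicalSpace X] [TopologicalSpace Y] {φ : Flow ℝ X}
    {ψ : Flow ℝ Y} {F : ∀ i, T i ≃ₜ T' i} (hF : PreservesHolonomy φ ψ fun i => F i) :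
    PreservesHolonomy ψ φ fun i => (F i).symm := by
  intro i j x y
  have := hF i j ((F i).symm x) ((F j).symm y)
  simp only [Homeomorph.apply_symm_apply] at this
  exact this.symm

section

variable [TopologicalSpace X] [TopologicalSpace Y] [MeasurableSpace X] [MeasurableSpace Y]
  {φ : Flow ℝ X} {ψ : Flow ℝ Y}

theorem CarriesTransverseMeasures.symm [BorelSpace X] [BorelSpace Y] {F : ∀ i, T i ≃ₜ T' i}
    {μ : Measure X} {ν : Measure Y}
    (h : CarriesTransverseMeasures φ ψ (fun i => (F i : T i → T' i)) μ ν) :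
    CarriesTransverseMeasures ψ φ (fun i => ((F i).symm : T' i → T i)) ν μ := by
  intro i U ε U' ε' hU hU' B hB
  have := h i U' ε' U ε hU' hU ((F i).symm ⁻¹' B) ((F i).symm.measurable hB)
  rw [← preimage_comp, Homeomorph.symm_comp_self, preimage_id] at this
  exact this.symm

theorem CarriesTransverseMeasures.smul {F : ∀ i, T i → T' i} {μ : Measure X} {ν : Measure Y}
    (h : CarriesTransverseMeasures φ ψ F μ ν) (a : ENNReal) :
    CarriesTransverseMeasures φ ψ F (a • μ) (a • ν) := by
  intro i U ε U' ε' hU hU' B hB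
  have := h i U ε U' ε' hU hU' B hB
  simp only [Flow.transverseMeasure, Measure.smul_apply, smul_eq_mul, mul_div_assoc] at this ⊢
  rw [this]

theorem CarriesTransverseMeasures.zero {F : ∀ i, T i → T' i} :
    CarriesTransverseMeasures φ ψ F (0 : Measure X) (0 : Measure Y) := by
  intro i U ε U' ε' hU hU' B hB
  simp [Flow.transverseMeasure]

theorem Flow.IsInvariantMeasure.smul {μ : Measure X} (h : φ.IsInvariantMeasure μ) (a : ENNReal) :
    φ.IsInvariantMeasure (a • μ) := by
  intro t A hA
  rw [Measure.smul_apply, Measure.smul_apply, h t A hA]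

/-- Measures are carried to each other if and only if the corresponding measures on the cross
sections are. -/
theorem carriesTransverseMeasures_iff [StandardBorelSpace X] [StandardBorelSpace Y]
    (hφ : φ.IsCompleteTransversals T) (hψ : ψ.IsCompleteTransversals T')
    (hT : ∀ i, MeasurableSet (T i)) (hT' : ∀ i, MeasurableSet (T' i)) (F : ∀ i, T i ≃ T' i)
    (hF : ∀ i, Measurable (F i)) {μ : Measure X} {ν : Measure Y} {m : Measure (DisjointUnion T)}
    {m' : Measure (DisjointUnion T')} [IsFiniteMeasure m] [IsFiniteMeasure m']
    (hm : φ.Corresponds point μ m) (hm' : ψ.Corresponds point ν m') :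
    CarriesTransverseMeasures φ ψ (fun i => (F i : T i → T' i)) μ ν ↔
      m.map (DisjointUnion.congr F) = m' := by
  have hc := measurable_congr hT F hF
  have hmap : ∀ (i : Fin n) (B : Set (T' i)), MeasurableSet B →
      m.map (DisjointUnion.congr F) (incl T' i '' B) = m (incl T i '' (F i ⁻¹' B)) := by
    intro i B hB
    rw [Measure.map_apply hc (measurableSet_image_incl hT' hB), congr_preimage_image_incl]
  constructor
  · intro h
    refine measure_ext hT' fun i B hB => ?_
    obtain ⟨U, ε, hU⟩ := hφ.1 i
    obtain ⟨U', ε', hU'⟩ := hψ.1 i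
    rw [hmap i B hB, ← hm.transverseMeasure_eq hT hU (hF i hB), h i U ε U' ε' hU hU' B hB,
      hm'.transverseMeasure_eq hT' hU' hB]
  · rintro h i U ε U' ε' hU hU' B hB
    rw [hm.transverseMeasure_eq hT hU (hF i hB), hm'.transverseMeasure_eq hT' hU' hB, ← h,
      hmap i B hB]

end

variable [MetricSpace X] [CompactSpace X] [MeasurableSpace X] [BorelSpace X]
  [MetricSpace Y] [CompactSpace Y] [MeasurableSpace Y] [BorelSpace Y]
  {φ : Flow ℝ X} {ψ : Flow ℝ Y}

/-- A finite invariant measure is carried to exactly one finite invariant measure. -/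
theorem existsUnique_carriesTransverseMeasures (hφ : φ.IsCompleteTransversals T)
    (hψ : ψ.IsCompleteTransversals T') (F : ∀ i, T i ≃ₜ T' i)
    (hF : PreservesHolonomy φ ψ fun i => (F i : T i → T' i)) {μ : Measure X}
    (hμf : IsFiniteMeasure μ) (hμ : φ.IsInvariantMeasure μ) :
    ∃! ν : Measure Y, (IsFiniteMeasure ν ∧ ψ.IsInvariantMeasure ν) ∧
      CarriesTransverseMeasures φ ψ (fun i => (F i : T i → T' i)) μ ν := by
  have hT : ∀ i, MeasurableSet (T i) := fun i => (hφ.1 i).measurableSet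
  have hT' : ∀ i, MeasurableSet (T' i) := fun i => (hψ.1 i).measurableSet
  have := standardBorelSpace hT
  have := standardBorelSpace hT'
  obtain ⟨ε, hs⟩ := hφ.exists_isCrossSection
  obtain ⟨ε', hs'⟩ := hψ.exists_isCrossSection
  have hc := measurable_congr hT (fun i => (F i).toEquiv) fun i => (F i).measurable
  have hc' := measurable_congr hT' (fun i => (F i).symm.toEquiv) fun i => (F i).symm.measurable
  obtain ⟨m, hmf, hm⟩ := hs.exists_corresponds_of_isInvariantMeasure hμ
  have hinv := (hs.holonomyInvariant_of_corresponds hm).map_congr (fun i => (F i).toEquiv) hF hc hc'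
  obtain ⟨ν, hν⟩ := hs'.exists_corresponds_of_holonomyInvariant hinv
  have key := fun (ν' : Measure Y) (m' : Measure (DisjointUnion T')) (_ : IsFiniteMeasure m')
    (h : ψ.Corresponds point ν' m') => carriesTransverseMeasures_iff hφ hψ hT hT'
      (fun i => (F i).toEquiv) (fun i => (F i).measurable) hm h
  refine ⟨ν, ⟨⟨hν.isFiniteMeasure hψ hT', hs'.isInvariantMeasure_of_corresponds hν⟩,
    (key ν _ inferInstance hν).2 rfl⟩, ?_⟩
  -- Any competitor comes from some `m'`, which must be the push-forward of `m`, and a measure on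
  -- the cross section determines the measure on the space.
  rintro ν' ⟨⟨hν'f, hν'i⟩, hν'c⟩
  obtain ⟨m', hm'f, hm'⟩ := hs'.exists_corresponds_of_isInvariantMeasure hν'i
  obtain rfl := (key ν' m' hm'f hm').1 hν'c
  exact hs'.corresponds_unique_left hm' hν

/-- The correspondence commutes with scalars and matches zero only with zero, so it matches the rays
of invariant measures even though it may change total mass. -/
theorem Flow.IsUniquelyErgodic.of_preservesHolonomy (hφ : φ.IsCompleteTransversals T)
    (hψ : ψ.IsCompleteTransversals T') (F : ∀ i, T i ≃ₜ T' i)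
    (hF : PreservesHolonomy φ ψ fun i => (F i : T i → T' i)) (h : φ.IsUniquelyErgodic) :
    ψ.IsUniquelyErgodic := by
  obtain ⟨μ, ⟨hμp, hμ⟩, huniq⟩ := h
  obtain ⟨ν, ⟨⟨hνf, hν⟩, hμν⟩, hνu⟩ :=
    existsUnique_carriesTransverseMeasures hφ hψ F hF inferInstance hμ
  have hback := fun (ν' : Measure Y) (hf : IsFiniteMeasure ν') (hi : ψ.IsInvariantMeasure ν') =>
    existsUnique_carriesTransverseMeasures hψ hφ (fun i => (F i).symm) hF.symm hf hi
  have hne : ∀ (μ' : Measure X) (ν' : Measure Y), IsFiniteMeasure μ' → φ.IsInvariantMeasure μ' →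
      IsFiniteMeasure ν' → ψ.IsInvariantMeasure ν' →
      CarriesTransverseMeasures φ ψ (fun i => (F i : T i → T' i)) μ' ν' → (μ' = 0 ↔ ν' = 0) := by
    intro μ' ν' h1 h2 h3 h4 h5
    constructor
    · rintro rfl
      exact (existsUnique_carriesTransverseMeasures hφ hψ F hF h1 h2).unique ⟨⟨h3, h4⟩, h5⟩
        ⟨⟨inferInstance, fun _ _ _ => rfl⟩, .zero⟩
    · rintro rfl
      exact (hback 0 h3 h4).unique ⟨⟨h1, h2⟩, h5.symm⟩ ⟨⟨inferInstance, fun _ _ _ => rfl⟩, .zero⟩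
  have hν0 : NeZero ν := ⟨fun h0 =>
    IsProbabilityMeasure.ne_zero μ ((hne μ ν inferInstance hμ hνf hν hμν).2 h0)⟩
  refine ⟨(ν univ)⁻¹ • ν, ⟨inferInstance, hν.smul _⟩, ?_⟩
  rintro ν' ⟨hν'p, hν'⟩
  obtain ⟨μ', ⟨⟨hμ'f, hμ'⟩, hνμ'⟩, -⟩ := hback ν' inferInstance hν'
  have hμν' := hνμ'.symm
  have hμ'0 : NeZero μ' := ⟨fun h0 =>
    IsProbabilityMeasure.ne_zero ν' ((hne μ' ν' hμ'f hμ' inferInstance hν' hμν').1 h0)⟩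
  have hμ'e := huniq ((μ' univ)⁻¹ • μ') ⟨inferInstance, hμ'.smul _⟩
  have h0 : μ' univ ≠ 0 := NeZero.ne _
  have hfin : (μ' univ)⁻¹ ≠ ⊤ := ENNReal.inv_ne_top.2 h0
  -- Uniqueness for `φ` rescales `μ'` to `μ`, so the same multiple of `ν'` is carried from `μ` and
  -- equals `ν`. As `ν'` has mass one, the factor is `ν univ`.
  have he := hνu ((μ' univ)⁻¹ • ν') ⟨⟨Measure.smul_finite _ hfin, hν'.smul _⟩,
    hμ'e ▸ hμν'.smul _⟩
  rw [← he, Measure.smul_apply, measure_univ (μ := ν'), smul_eq_mul, mul_one, inv_inv, smul_smul,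
    ENNReal.mul_inv_cancel h0 (measure_ne_top _ _), one_smul]

end Correspondence

theorem mainTheorem3 {X Y : Type*}
    [MetricSpace X] [CompactSpace X] [MeasurableSpace X] [BorelSpace X]
    [MetricSpace Y] [CompactSpace Y] [MeasurableSpace Y] [BorelSpace Y]
    (φ : Flow ℝ X) (ψ : Flow ℝ Y)
    (hφ : φ.HasNoFixedPoints) (hψ : ψ.HasNoFixedPoints)
    (n : ℕ) (T : Fin n → Set X) (T' : Fin n → Set Y)
    (hT : φ.IsCompleteTransversals T) (hT' : ψ.IsCompleteTransversals T')
    (F : ∀ i, T i ≃ₜ T' i)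
    (hF : PreservesHolonomy φ ψ (fun i => (F i : T i → T' i))) :
    (∃ Θ : φ.FiniteInvariantMeasure ≃ ψ.FiniteInvariantMeasure,
      ∀ (μ : φ.FiniteInvariantMeasure) (ν : ψ.FiniteInvariantMeasure),
        Θ μ = ν ↔
          CarriesTransverseMeasures φ ψ (fun i => (F i : T i → T' i)) μ.1 ν.1) ∧
    (φ.IsUniquelyErgodic ↔ ψ.IsUniquelyErgodic) := by
  have h1 := fun μ : φ.FiniteInvariantMeasure =>
    existsUnique_carriesTransverseMeasures hT hT' F hF μ.2.1 μ.2.2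
  have h2 := fun ν : ψ.FiniteInvariantMeasure =>
    existsUnique_carriesTransverseMeasures hT' hT (fun i => (F i).symm) hF.symm ν.2.1 ν.2.2
  choose f hf hfu using h1
  choose g hg _ using h2
  -- Injectivity is uniqueness for the inverse maps; surjectivity is existence for the inverse maps
  -- together with uniqueness for `F`.
  refine ⟨⟨Equiv.ofBijective (fun μ => (⟨f μ, (hf μ).1⟩ : ψ.FiniteInvariantMeasure)) ⟨?_, ?_⟩, ?_⟩,
    .of_preservesHolonomy hT hT' F hF, .of_preservesHolonomy hT' hT (fun i => (F i).symm) hF.symm⟩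
  · intro μ μ' h
    have hν : f μ = f μ' := congrArg Subtype.val h
    exact Subtype.ext ((existsUnique_carriesTransverseMeasures hT' hT (fun i => (F i).symm) hF.symm
      (hf μ).1.1 (hf μ).1.2).unique ⟨μ.2, (hf μ).2.symm⟩ ⟨μ'.2, hν ▸ (hf μ').2.symm⟩)
  · intro ν
    exact ⟨⟨g ν, (hg ν).1⟩, Subtype.ext (hfu ⟨g ν, (hg ν).1⟩ ν.1 ⟨ν.2, (hg ν).2.symm⟩).symm⟩
  · intro μ ν
    constructor
    · rintro rfl
      exact (hf μ).2
    · intro h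
      exact Subtype.ext (hfu μ ν.1 ⟨ν.2, h⟩).symm
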